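/- **Proposition 1.** Let $\gamma>0$ and $c\in(0,\infty)$, and consider a sequence of problems indexed by $k\in\mathbb N$ (the index is suppressed below) with dimension $p\to\infty$ and sample sizes $n_0,n_1\to\infty$, means $\mu_0,\mu_1\in\mathbb R^p$ and positive semidefinite covariance matrices $\Sigma_0,\Sigma_1\in\mathbb R^{p\times p}$. Assume that 1. $n_0-n_1=o(1)$ and $p/(n_0+n_1)\to c$; 2. $\|\mu_0-\mu_1\|^2=O(\sqrt p)$; 3. $\|\Sigma_i\|=O(1)$ in spectral norm, $i\in\{0,1\}$; 4. $\Sigma_0-\Sigma_1$ has $O(\sqrt p)$ eigenvalues of order $O(1)$ and the remaining ones are of order $O(1/\sqrt p)$. Let the training samples $x_{i,1},\dots,x_{i,n_i}\sim\mathcal N(\mu_i,\Sigma_i)$, $i\in\{0,1\}$, be independent, and let $z\sim\mathcal N(0,I_p)$ be independent of them. Put $$\hat\mu_i=\frac1{n_i}\sum_l x_{i,l},\qquad \hat\Sigma_i=\frac1{n_i-1}\sum_l (x_{i,l}-\hat\mu_i)(x_{i,l}-\hat\mu_i)^T,\qquad H_i=(I_p+\gamma\hat\Sigma_i)^{-1},$$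 $$B_i=\Sigma_i^{1/2}(H_1-H_0)\Sigma_i^{1/2},\qquad r_i=\Sigma_i^{1/2}\left[H_1(\mu_i-\hat\mu_1)-H_0(\mu_i-\hat\mu_0)\right].$$ For $i\in\{0,1\}$ consider, for a realization of the training samples, the condition that eventually $2\,\mathrm{tr} B_i^2+4\|r_i\|^2>0$ and $$\lim_{k\to\infty}\frac{60\,\mathrm{tr} B_i^2+240\,\mathrm{tr} B_i^2\,\|r_i\|^2+48\|r_i\|^4}{\left(2\,\mathrm{tr} B_i^2+4\|r_i\|^2\right)^2}=0.\qquad(\ast)$$ Then for each $i\in\{0,1\}$: * for almost every realization of the training samples at which $(\ast)$ holds, the conditional distribution, given the training samples, of $$\frac{z^TB_iz+2z^Tr_i-\mathrm{tr} B_i}{\sqrt{2\,\mathrm{tr} B_i^2+4\|r_i\|^2}}$$ converges weakly to $\mathcal N(0,1)$; * if $(\ast)$ holds almost surely, then this statistic also converges in distribution to $\mathcal N(0,1)$ unconditionally. -/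

import Mathlib

open MeasureTheory ProbabilityTheory Filter Topology Asymptotics
open scoped Matrix MatrixOrder

noncomputable section

/-- Training data: for each class `i ∈ {0, 1}`, a family of `n i` observations in `ℝ^p`. -/
abbrev TrainingSet (p : ℕ) (n : Fin 2 → ℕ) : Type :=
  (i : Fin 2) → Fin (n i) → EuclideanSpace ℝ (Fin p)

/-- Sample mean `(1/m) ∑ₗ xₗ`. -/
def sampleMean {p m : ℕ} (x : Fin m → EuclideanSpace ℝ (Fin p)) : EuclideanSpace ℝ (Fin p) :=
  (m : ℝ)⁻¹ • ∑ l, x l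

/-- Sample covariance matrix `(1/(m-1)) ∑ₗ (xₗ - x̄)(xₗ - x̄)ᵀ`. -/
def sampleCov {p m : ℕ} (x : Fin m → EuclideanSpace ℝ (Fin p)) : Matrix (Fin p) (Fin p) ℝ :=
  ((m : ℝ) - 1)⁻¹ •
    ∑ l, Matrix.vecMulVec (x l - sampleMean x).ofLp (x l - sampleMean x).ofLp

/-- Ridge estimator of the inverse covariance matrix, `H = (I + γ Σ̂)⁻¹`. -/
def ridgeInv {p m : ℕ} (γ : ℝ) (x : Fin m → EuclideanSpace ℝ (Fin p)) :
    Matrix (Fin p) (Fin p) ℝ :=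
  (1 + γ • sampleCov x)⁻¹

/-- `B_i = Σ_i^{1/2} (H_1 - H_0) Σ_i^{1/2}`. -/
def qdaB {p : ℕ} {n : Fin 2 → ℕ} (γ : ℝ) (S : Fin 2 → Matrix (Fin p) (Fin p) ℝ)
    (x : TrainingSet p n) (i : Fin 2) : Matrix (Fin p) (Fin p) ℝ :=
  CFC.sqrt (S i) * (ridgeInv γ (x 1) - ridgeInv γ (x 0)) * CFC.sqrt (S i)

/-- `r_i = Σ_i^{1/2} [H_1 (μ_i - μ̂_1) - H_0 (μ_i - μ̂_0)]`. -/
def qdaR {p : ℕ} {n : Fin 2 → ℕ} (γ : ℝ) (μ : Fin 2 → EuclideanSpace ℝ (Fin p))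
    (S : Fin 2 → Matrix (Fin p) (Fin p) ℝ) (x : TrainingSet p n) (i : Fin 2) :
    EuclideanSpace ℝ (Fin p) :=
  WithLp.toLp 2 (CFC.sqrt (S i) *ᵥ
    (ridgeInv γ (x 1) *ᵥ (μ i - sampleMean (x 1)).ofLp
      - ridgeInv γ (x 0) *ᵥ (μ i - sampleMean (x 0)).ofLp))

/-- `2 tr B² + 4 ‖r‖²`. -/
def quadVar {p : ℕ} (B : Matrix (Fin p) (Fin p) ℝ) (r : EuclideanSpace ℝ (Fin p)) : ℝ :=
  2 * (B ^ 2).trace + 4 * ‖r‖ ^ 2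

/-- `(60 tr B² + 240 tr B² ‖r‖² + 48 ‖r‖⁴) / (2 tr B² + 4 ‖r‖²)²`. -/
def lyapunovRatio {p : ℕ} (B : Matrix (Fin p) (Fin p) ℝ) (r : EuclideanSpace ℝ (Fin p)) : ℝ :=
  (60 * (B ^ 2).trace + 240 * (B ^ 2).trace * ‖r‖ ^ 2 + 48 * ‖r‖ ^ 4) / quadVar B r ^ 2

/-- `(zᵀ B z + 2 zᵀ r - tr B) / √(2 tr B² + 4 ‖r‖²)`. -/
def quadStat {p : ℕ} (B : Matrix (Fin p) (Fin p) ℝ) (r z : EuclideanSpace ℝ (Fin p)) : ℝ :=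
  (z.ofLp ⬝ᵥ (B *ᵥ z.ofLp) + 2 * (z.ofLp ⬝ᵥ r.ofLp) - B.trace) / √(quadVar B r)

/-- The Lyapunov-type condition along a sequence: the denominators are eventually positive (so
that the ratio is meaningful) and the ratio tends to `0`. -/
def LyapunovCond {p : ℕ → ℕ} (B : (k : ℕ) → Matrix (Fin (p k)) (Fin (p k)) ℝ)
    (r : (k : ℕ) → EuclideanSpace ℝ (Fin (p k))) : Prop :=
  (∀ᶠ k in atTop, 0 < quadVar (B k) (r k)) ∧
    Tendsto (fun k => lyapunovRatio (B k) (r k)) atTop (𝓝 0)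

/-- The symmetric matrix `A` has `O(√p)` eigenvalues (with multiplicity) of order `O(1)` and all
remaining eigenvalues are of order `O(1/√p)`, along a sequence of dimensions. -/
def FewLargeEigenvalues {p : ℕ → ℕ} {A : (k : ℕ) → Matrix (Fin (p k)) (Fin (p k)) ℝ}
    (hA : ∀ k, (A k).IsHermitian) : Prop :=
  ∃ M : ℝ, ∀ᶠ k in atTop, ∃ J : Finset (Fin (p k)),
    (J.card : ℝ) ≤ M * √(p k) ∧
    (∀ j ∈ J, |(hA k).eigenvalues j| ≤ M) ∧
    ∀ j ∉ J, |(hA k).eigenvalues j| ≤ M / √(p k)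

end

/-!
In an orthonormal eigenbasis of `B`, with eigenvalues `a j` and with `b j` the coordinates of `r`,
the numerator of `quadStat` is a sum of independent centred variables `a (x² - 1) + 2 b x`, `x`
standard Gaussian. Such a variable has second moment `2a² + 4b²` and fourth moment
`60a⁴ + 240a²b² + 48b⁴`, which is where the constants of `lyapunovRatio` come from. Since
`-S ≤ B ≤ S` in the Loewner order, the eigenvalues of `B` stay bounded, so the sum of the fourth
moments is at most a constant times the numerator of `lyapunovRatio` although the latter features
`tr B²` instead of `tr B⁴`. Hence `LyapunovCond` implies Lyapunov's condition with exponent four.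
As the noise `z` is independent of the training data, conditioning on the latter amounts to freezing
`B` and `r`, and averaging the conditional limits gives the unconditional one.
-/

section CharFun

lemma norm_prod_sub_prod_le {ι R : Type*} [NormedCommRing R] [NormOneClass R] (s : Finset ι)
    (f g : ι → R) (hf : ∀ i ∈ s, ‖f i‖ ≤ 1) (hg : ∀ i ∈ s, ‖g i‖ ≤ 1) :
    ‖∏ i ∈ s, f i - ∏ i ∈ s, g i‖ ≤ ∑ i ∈ s, ‖f i - g i‖ := by
  classical
  induction s using Finset.induction_on with
  | empty => simp
  | insert a s ha ih =>
    simp only [Finset.forall_mem_insert] at hf hg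
    rw [Finset.prod_insert ha, Finset.prod_insert ha, Finset.sum_insert ha]
    have hfs : ‖∏ i ∈ s, f i‖ ≤ 1 :=
      (Finset.norm_prod_le s f).trans (Finset.prod_le_one (fun _ _ => norm_nonneg _) hf.2)
    calc ‖f a * ∏ i ∈ s, f i - g a * ∏ i ∈ s, g i‖
        = ‖(f a - g a) * ∏ i ∈ s, f i + g a * (∏ i ∈ s, f i - ∏ i ∈ s, g i)‖ := by
          congr 1
          ring
      _ ≤ ‖f a - g a‖ * ‖∏ i ∈ s, f i‖ + ‖g a‖ * ‖∏ i ∈ s, f i - ∏ i ∈ s, g i‖ := by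
          grw [norm_add_le, norm_mul_le, norm_mul_le]
      _ ≤ ‖f a - g a‖ * 1 + 1 * ∑ i ∈ s, ‖f i - g i‖ := by
          gcongr
          exacts [hg.1, ih hf.2 hg.2]
      _ = ‖f a - g a‖ + ∑ i ∈ s, ‖f i - g i‖ := by ring

lemma norm_cexp_mul_I_sub_taylor_le (x : ℝ) :
    ‖Complex.exp (x * Complex.I) - (1 + x * Complex.I - x ^ 2 / 2)‖ ≤ 4 * |x| ^ 3 := by
  rcases le_total |x| 1 with h | h
  · have hsum : ∑ m ∈ Finset.range 3, (x * Complex.I) ^ m / (m.factorial : ℂ) =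
        1 + x * Complex.I - x ^ 2 / 2 := by
      simp only [Finset.sum_range_succ, Finset.sum_range_zero, mul_pow, Nat.factorial,
        Complex.I_sq]
      push_cast
      ring
    have htaylor := Complex.norm_exp_sub_sum_le_norm_mul_exp (x * Complex.I) 3
    rw [hsum, norm_mul, Complex.norm_I, mul_one, Complex.norm_real, Real.norm_eq_abs] at htaylor
    have hexp : Real.exp |x| ≤ 4 := by
      linarith [Real.exp_le_exp.2 h, Real.exp_one_lt_d9]
    calc _ ≤ |x| ^ 3 * Real.exp |x| := htaylor
      _ ≤ |x| ^ 3 * 4 := by gcongr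
      _ = 4 * |x| ^ 3 := mul_comm _ _
  · have hpoly : ‖(1 : ℂ) + x * Complex.I - x ^ 2 / 2‖ ≤ 1 + |x| + |x| ^ 2 / 2 := by
      grw [norm_sub_le, norm_add_le]
      simp
    have h3 : |x| ≤ |x| ^ 3 := le_self_pow₀ h (by norm_num)
    have h4 : |x| ^ 2 ≤ |x| ^ 3 := pow_le_pow_right₀ h (by norm_num)
    grw [norm_sub_le, Complex.norm_exp_ofReal_mul_I, hpoly]
    linarith

lemma abs_exp_neg_sub_one_sub_le {s : ℝ} (hs : 0 ≤ s) : |Real.exp (-s) - (1 - s)| ≤ s ^ 2 := by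
  rcases le_total s 1 with h | h
  · have := Real.abs_exp_sub_one_sub_id_le (x := -s) (by rwa [abs_neg, abs_of_nonneg hs])
    rwa [neg_sq, sub_sub, ← sub_eq_add_neg] at this
  · have h1 : Real.exp (-s) ≤ 1 := Real.exp_le_one_iff.2 (by linarith)
    have h2 := Real.exp_pos (-s)
    rw [abs_le]
    constructor <;> nlinarith

variable {Ω : Type*} [MeasurableSpace Ω] {P : Measure Ω}

lemma memLp_sq {X : Ω → ℝ} {p : ENNReal} (hX : MemLp X (p * 2) P) :
    MemLp (fun ω => X ω ^ 2) p P := by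
  convert! hX.norm_rpow_div 2 using 1
  · simp
  · rw [ENNReal.mul_div_cancel_right two_ne_zero ENNReal.ofNat_ne_top]

variable [IsProbabilityMeasure P]

lemma integral_abs_pow_three_le {X : Ω → ℝ} (hX : MemLp X 4 P) :
    ∫ ω, |X ω| ^ 3 ∂P ≤ √(∫ ω, X ω ^ 2 ∂P) * √(∫ ω, X ω ^ 4 ∂P) := by
  have hX2 : MemLp X 2 P := hX.mono_exponent (by norm_num)
  have hXsq : MemLp (fun ω => X ω ^ 2) 2 P := memLp_sq (by norm_num [hX])
  have h := integral_mul_le_Lp_mul_Lq_of_nonneg (μ := P) (f := fun ω => |X ω|)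
    (g := fun ω => X ω ^ 2) Real.HolderConjugate.two_two (ae_of_all _ fun ω => abs_nonneg _)
    (ae_of_all _ fun ω => sq_nonneg _) (by simpa using hX2.norm) (by simpa using hXsq)
  simp only [Real.rpow_two, sq_abs, ← pow_mul, ← Real.sqrt_eq_rpow] at h
  convert! h using 3 with ω
  rw [← sq_abs, pow_succ']

lemma sq_integral_sq_le {X : Ω → ℝ} (hX : MemLp X 4 P) :
    (∫ ω, X ω ^ 2 ∂P) ^ 2 ≤ ∫ ω, X ω ^ 4 ∂P := by
  have hXsq : MemLp (fun ω => X ω ^ 2) 2 P := memLp_sq (by norm_num [hX])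
  have h := variance_nonneg (fun ω => X ω ^ 2) P
  rw [variance_eq_sub hXsq] at h
  simpa [← pow_mul] using h

lemma norm_charFun_sub_taylor_le {X : Ω → ℝ} (hX : MemLp X 3 P) (hX0 : ∫ ω, X ω ∂P = 0)
    (t : ℝ) :
    ‖charFun (P.map X) t - ((1 - t ^ 2 * (∫ ω, X ω ^ 2 ∂P) / 2 : ℝ) : ℂ)‖ ≤
      4 * |t| ^ 3 * ∫ ω, |X ω| ^ 3 ∂P := by
  have hXm := hX.aestronglyMeasurable
  have hX1 : Integrable (fun ω => ((t * X ω : ℝ) : ℂ) * Complex.I) P :=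
    ((hX.integrable (by norm_num)).const_mul t).ofReal.mul_const _
  have hX2 : Integrable (fun ω => ((t * X ω : ℝ) : ℂ) ^ 2 / 2) P := by
    convert! (((hX.mono_exponent (p := 2) (by norm_num)).const_mul t).integrable_sq).ofReal (𝕜 := ℂ)
      |>.div_const 2 using 2 with ω
    simp
  have hX3 : Integrable (fun ω => |X ω| ^ 3) P :=
    MemLp.integrable_norm_pow (p := 3) hX three_ne_zero
  have hexp : Integrable (fun ω => Complex.exp ((t * X ω : ℝ) * Complex.I)) P :=
    Integrable.of_bound (by fun_prop) 1 (ae_of_all _ fun ω =>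
      (Complex.norm_exp_ofReal_mul_I _).le)
  have htaylor : Integrable
      (fun ω => (1 : ℂ) + (t * X ω : ℝ) * Complex.I - ((t * X ω : ℝ) : ℂ) ^ 2 / 2) P :=
    ((integrable_const 1).add hX1).sub hX2
  have hmean : ∫ ω, ((1 : ℂ) + (t * X ω : ℝ) * Complex.I - ((t * X ω : ℝ) : ℂ) ^ 2 / 2) ∂P =
      ((1 - t ^ 2 * (∫ ω, X ω ^ 2 ∂P) / 2 : ℝ) : ℂ) := by
    rw [integral_sub ((integrable_const 1).fun_add hX1) hX2, integral_add (integrable_const 1) hX1,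
      integral_mul_const, integral_complex_ofReal, integral_const_mul, hX0, integral_div]
    simp_rw [← Complex.ofReal_pow, integral_complex_ofReal, mul_pow, integral_const_mul]
    simp
  have hchar : charFun (P.map X) t = ∫ ω, Complex.exp ((t * X ω : ℝ) * Complex.I) ∂P := by
    rw [charFun_apply_real, integral_map hXm.aemeasurable (by fun_prop)]
    simp only [Complex.ofReal_mul]
  rw [hchar, ← hmean, ← integral_sub hexp htaylor, ← integral_const_mul]
  refine norm_integral_le_of_norm_le (hX3.const_mul _) (ae_of_all _ fun ω => ?_)
  simpa only [abs_mul, mul_pow, mul_assoc] using norm_cexp_mul_I_sub_taylor_le (t * X ω)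

lemma norm_charFun_sub_exp_le {X : Ω → ℝ} (hX : MemLp X 4 P) (hX0 : ∫ ω, X ω ∂P = 0) (t : ℝ) :
    ‖charFun (P.map X) t - Real.exp (-(t ^ 2 * (∫ ω, X ω ^ 2 ∂P) / 2))‖ ≤
      4 * |t| ^ 3 * (√(∫ ω, X ω ^ 2 ∂P) * √(∫ ω, X ω ^ 4 ∂P)) +
        t ^ 4 / 4 * ∫ ω, X ω ^ 4 ∂P := by
  set v := ∫ ω, X ω ^ 2 ∂P
  have : 0 ≤ v := integral_nonneg fun ω => sq_nonneg _
  have hgauss : ‖((1 - t ^ 2 * v / 2 : ℝ) : ℂ) - Real.exp (-(t ^ 2 * v / 2))‖ ≤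
      t ^ 4 / 4 * ∫ ω, X ω ^ 4 ∂P := by
    rw [norm_sub_rev, ← Complex.ofReal_sub, Complex.norm_real, Real.norm_eq_abs]
    grw [abs_exp_neg_sub_one_sub_le (by positivity), ← sq_integral_sq_le hX]
    apply le_of_eq
    ring
  grw [norm_sub_le_norm_sub_add_norm_sub _ ((1 - t ^ 2 * v / 2 : ℝ) : ℂ), hgauss,
    norm_charFun_sub_taylor_le (hX.mono_exponent (by norm_num)) hX0 t,
    integral_abs_pow_three_le hX]

lemma norm_charFun_sum_sub_exp_le {ι : Type*} [Fintype ι] {Y : ι → Ω → ℝ}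
    (hY : ∀ j, MemLp (Y j) 4 P) (hY0 : ∀ j, ∫ ω, Y j ω ∂P = 0) (hind : iIndepFun Y P) (t : ℝ) :
    ‖charFun (P.map fun ω => ∑ j, Y j ω) t -
        Real.exp (-(t ^ 2 * (∑ j, ∫ ω, Y j ω ^ 2 ∂P) / 2))‖ ≤
      4 * |t| ^ 3 * (√(∑ j, ∫ ω, Y j ω ^ 2 ∂P) * √(∑ j, ∫ ω, Y j ω ^ 4 ∂P)) +
        t ^ 4 / 4 * ∑ j, ∫ ω, Y j ω ^ 4 ∂P := by
  have hYm (j) : AEMeasurable (Y j) P := (hY j).aestronglyMeasurable.aemeasurable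
  have hprob (j) : IsProbabilityMeasure (P.map (Y j)) := Measure.isProbabilityMeasure_map (hYm j)
  have hprod : (Real.exp (-(t ^ 2 * (∑ j, ∫ ω, Y j ω ^ 2 ∂P) / 2)) : ℂ) =
      ∏ j, (Real.exp (-(t ^ 2 * (∫ ω, Y j ω ^ 2 ∂P) / 2)) : ℂ) := by
    rw [← Complex.ofReal_prod, ← Real.exp_sum, Finset.sum_neg_distrib, Finset.mul_sum,
      Finset.sum_div]
  have hexp (j) : ‖(Real.exp (-(t ^ 2 * (∫ ω, Y j ω ^ 2 ∂P) / 2)) : ℂ)‖ ≤ 1 := by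
    rw [Complex.norm_real, Real.norm_eq_abs, Real.abs_exp, Real.exp_le_one_iff, neg_nonpos]
    positivity
  rw [iIndepFun.charFun_map_fun_sum_eq_prod hYm hind, Finset.prod_apply, hprod]
  grw [norm_prod_sub_prod_le _ _ _ (fun j _ => norm_charFun_le_one t) fun j _ => hexp j]
  calc _ ≤ ∑ j, (4 * |t| ^ 3 * (√(∫ ω, Y j ω ^ 2 ∂P) * √(∫ ω, Y j ω ^ 4 ∂P)) +
        t ^ 4 / 4 * ∫ ω, Y j ω ^ 4 ∂P) :=
        Finset.sum_le_sum fun j _ => norm_charFun_sub_exp_le (hY j) (hY0 j) t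
    _ ≤ _ := by
        rw [Finset.sum_add_distrib, ← Finset.mul_sum, ← Finset.mul_sum]
        gcongr
        exact Real.sum_sqrt_mul_sqrt_le _ (fun j => by positivity) fun j => by positivity

lemma norm_charFun_sum_div_sqrt_sub_exp_le {ι : Type*} [Fintype ι] {Y : ι → Ω → ℝ}
    (hY : ∀ j, MemLp (Y j) 4 P) (hY0 : ∀ j, ∫ ω, Y j ω ∂P = 0) (hind : iIndepFun Y P) {v : ℝ}
    (hv : 0 < v) (hYv : ∑ j, ∫ ω, Y j ω ^ 2 ∂P = v) (t : ℝ) :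
    ‖charFun (P.map fun ω => (∑ j, Y j ω) / √v) t - Real.exp (-(t ^ 2 / 2))‖ ≤
      4 * |t| ^ 3 * √((∑ j, ∫ ω, Y j ω ^ 4 ∂P) / v ^ 2) +
        t ^ 4 / 4 * ((∑ j, ∫ ω, Y j ω ^ 4 ∂P) / v ^ 2) := by
  have hYm (j) : AEMeasurable (Y j) P := (hY j).aestronglyMeasurable.aemeasurable
  have h := norm_charFun_sum_sub_exp_le hY hY0 hind ((√v)⁻¹ * t)
  set m := ∑ j, ∫ ω, Y j ω ^ 4 ∂P
  have hm : 0 ≤ m := by positivity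
  obtain ⟨s, hs, rfl⟩ : ∃ s > 0, s ^ 2 = v := ⟨√v, Real.sqrt_pos.2 hv, Real.sq_sqrt hv.le⟩
  rw [hYv, ← charFun_map_mul_comp (by fun_prop), Real.sqrt_sq hs.le, abs_mul, abs_inv,
    abs_of_pos hs] at h
  rw [Real.sqrt_sq hs.le, Real.sqrt_div hm, Real.sqrt_sq (by positivity)]
  simp only [div_eq_inv_mul (∑ j, Y j _)]
  convert h using 2
  · congr 4
    field_simp
  · field_simp
  · field_simp

end CharFun

section LyapunovCLT

theorem tendstoInDistribution_sum_div_sqrt_of_lyapunov {ι Ω : ℕ → Type*} [∀ k, Fintype (ι k)]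
    [∀ k, MeasurableSpace (Ω k)] {P : (k : ℕ) → Measure (Ω k)} [∀ k, IsProbabilityMeasure (P k)]
    {Y : (k : ℕ) → ι k → Ω k → ℝ} (hY : ∀ k j, MemLp (Y k j) 4 (P k))
    (hY0 : ∀ k j, ∫ ω, Y k j ω ∂(P k) = 0) (hind : ∀ k, iIndepFun (Y k) (P k))
    (hpos : ∀ᶠ k in atTop, 0 < ∑ j, ∫ ω, Y k j ω ^ 2 ∂(P k))
    (hlyap : Tendsto (fun k => (∑ j, ∫ ω, Y k j ω ^ 4 ∂(P k)) /
      (∑ j, ∫ ω, Y k j ω ^ 2 ∂(P k)) ^ 2) atTop (𝓝 0)) :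
    TendstoInDistribution (fun k ω => (∑ j, Y k j ω) / √(∑ j, ∫ ω', Y k j ω' ^ 2 ∂(P k))) atTop
      (id : ℝ → ℝ) P (gaussianReal 0 1) := by
  have hYm (k) (j) : AEMeasurable (Y k j) (P k) := (hY k j).aestronglyMeasurable.aemeasurable
  refine ⟨fun k => by fun_prop, aemeasurable_id, ?_⟩
  refine ProbabilityMeasure.tendsto_iff_tendsto_charFun.2 fun t => ?_
  have hbound := (hlyap.sqrt.const_mul (4 * |t| ^ 3)).add (hlyap.const_mul (t ^ 4 / 4))
  have hgauss : charFun (gaussianReal 0 1) t = Real.exp (-(t ^ 2 / 2)) := by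
    simp [charFun_gaussianReal]
  simp only [Real.sqrt_zero, mul_zero, add_zero] at hbound
  refine tendsto_iff_norm_sub_tendsto_zero.2 (squeeze_zero' (.of_forall fun _ => norm_nonneg _)
    (hpos.mono fun k hk => ?_) hbound)
  simpa only [ProbabilityMeasure.coe_mk, Measure.map_id, hgauss] using
    norm_charFun_sum_div_sqrt_sub_exp_le (hY k) (hY0 k) (hind k) hk rfl t

end LyapunovCLT

section GaussianMoments

lemma integral_pow_add_two_gaussianReal (v : NNReal) (m : ℕ) :
    ∫ x, x ^ (m + 2) ∂(gaussianReal 0 v) = v * (m + 1) * ∫ x, x ^ m ∂(gaussianReal 0 v) := by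
  set M := mgf id (gaussianReal 0 v)
  have hmoment (n : ℕ) : ∫ x, x ^ n ∂(gaussianReal 0 v) = iteratedDeriv n M 0 := by
    rw [iteratedDeriv_mgf_zero (by simp [integrableExpSet_id_gaussianReal])]
    simp
  have hM : M = fun t => Real.exp (v * t ^ 2 / 2) := by simp [M, mgf_id_gaussianReal]
  have hderiv : deriv M = fun t => v * (t * M t) := by
    funext t
    have := ((((hasDerivAt_pow 2 t).const_mul (v : ℝ)).div_const 2).exp).deriv
    simp only [hM, this]
    push_cast
    ring
  have hMsmooth : ContDiff ℝ (m + 1 : ℕ) M := by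
    rw [hM]
    fun_prop
  rw [hmoment, hmoment, iteratedDeriv_succ', hderiv, iteratedDeriv_const_mul_field,
    iteratedDeriv_fun_mul contDiffAt_fun_id hMsmooth.contDiffAt,
    Finset.sum_eq_single 1]
  · simp [mul_assoc]
  · intro i _ hi
    simp [iteratedDeriv_fun_id_zero, hi]
  · simp

lemma integrable_pow_gaussianReal (v : NNReal) (m : ℕ) :
    Integrable (fun x : ℝ => x ^ m) (gaussianReal 0 v) := by
  refine (integrable_norm_iff (by fun_prop)).1 ?_
  simpa using (memLp_id_gaussianReal (μ := 0) (v := v) (m : NNReal)).integrable_norm_pow'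

lemma memLp_quadratic_gaussianReal (v : NNReal) (a b c : ℝ) {p : ENNReal} (hp : p ≠ ⊤) :
    MemLp (fun x => a * (x ^ 2 - c) + 2 * b * x) p (gaussianReal 0 v) := by
  have hx : MemLp (fun x : ℝ => x) p (gaussianReal 0 v) := memLp_id_gaussianReal' p hp
  have hxx : MemLp (fun x : ℝ => x ^ 2) p (gaussianReal 0 v) :=
    memLp_sq (memLp_id_gaussianReal' _ (ENNReal.mul_ne_top hp ENNReal.ofNat_ne_top))
  exact ((hxx.sub (memLp_const c)).const_mul a).add (hx.const_mul (2 * b))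

lemma integral_sum_mul_pow_gaussianReal (v : NNReal) {m : ℕ} (c : Fin m → ℝ) :
    ∫ x, ∑ j, c j * x ^ (j : ℕ) ∂(gaussianReal 0 v) =
      ∑ j, c j * ∫ x, x ^ (j : ℕ) ∂(gaussianReal 0 v) := by
  rw [integral_finsetSum Finset.univ fun (j : Fin m) _ =>
    (integrable_pow_gaussianReal v j).const_mul (c j)]
  simp only [integral_const_mul]

lemma integral_quadratic_gaussianReal (a b : ℝ) :
    ∫ x, (a * (x ^ 2 - 1) + 2 * b * x) ∂(gaussianReal 0 1) = 0 := by
  have h (x : ℝ) : a * (x ^ 2 - 1) + 2 * b * x = ∑ j, ![-a, 2 * b, a] j * x ^ (j : ℕ) := by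
    simp [Fin.sum_univ_succ]
    ring
  simp only [h, integral_sum_mul_pow_gaussianReal]
  simp [Fin.sum_univ_succ, integral_pow_add_two_gaussianReal]

lemma integral_quadratic_sq_gaussianReal (a b : ℝ) :
    ∫ x, (a * (x ^ 2 - 1) + 2 * b * x) ^ 2 ∂(gaussianReal 0 1) = 2 * a ^ 2 + 4 * b ^ 2 := by
  have h (x : ℝ) : (a * (x ^ 2 - 1) + 2 * b * x) ^ 2 = ∑ j, ![a ^ 2, -4 * a * b,
      -2 * a ^ 2 + 4 * b ^ 2, 4 * a * b, a ^ 2] j * x ^ (j : ℕ) := by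
    simp [Fin.sum_univ_succ]
    ring
  simp only [h, integral_sum_mul_pow_gaussianReal]
  simp [Fin.sum_univ_succ, integral_pow_add_two_gaussianReal]
  ring

lemma integral_quadratic_pow_four_gaussianReal (a b : ℝ) :
    ∫ x, (a * (x ^ 2 - 1) + 2 * b * x) ^ 4 ∂(gaussianReal 0 1) =
      60 * a ^ 4 + 240 * a ^ 2 * b ^ 2 + 48 * b ^ 4 := by
  have h (x : ℝ) : (a * (x ^ 2 - 1) + 2 * b * x) ^ 4 = ∑ j, ![a ^ 4, -8 * a ^ 3 * b,
      -4 * a ^ 4 + 24 * a ^ 2 * b ^ 2, 24 * a ^ 3 * b - 32 * a * b ^ 3,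
      6 * a ^ 4 - 48 * a ^ 2 * b ^ 2 + 16 * b ^ 4, -24 * a ^ 3 * b + 32 * a * b ^ 3,
      -4 * a ^ 4 + 24 * a ^ 2 * b ^ 2, 8 * a ^ 3 * b, a ^ 4] j * x ^ (j : ℕ) := by
    simp [Fin.sum_univ_succ]
    ring
  simp only [h, integral_sum_mul_pow_gaussianReal]
  simp [Fin.sum_univ_succ, integral_pow_add_two_gaussianReal]
  ring

end GaussianMoments

section StdGaussianCoordinates

variable {ι E : Type*} [Fintype ι] [NormedAddCommGroup E] [InnerProductSpace ℝ E]
  [FiniteDimensional ℝ E] [MeasurableSpace E] [BorelSpace E]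

lemma map_inner_stdGaussian (b : OrthonormalBasis ι ℝ E) :
    (stdGaussian E).map (fun z j => inner ℝ (b j) z) = Measure.pi fun _ => gaussianReal 0 1 := by
  rw [stdGaussian_eq_map_pi_orthonormalBasis b, Measure.map_map (by fun_prop) (by fun_prop)]
  convert! Measure.map_id
  exact funext fun x => funext fun j => b.orthonormal.inner_right_fintype x j

lemma hasLaw_inner_stdGaussian (b : OrthonormalBasis ι ℝ E) (j : ι) :
    HasLaw (fun z => inner ℝ (b j) z) (gaussianReal 0 1) (stdGaussian E) :=
  (measurePreserving_eval (fun _ : ι => gaussianReal 0 1) j).fun_comp_hasLaw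
    ⟨by fun_prop, map_inner_stdGaussian b⟩

lemma iIndepFun_inner_stdGaussian (b : OrthonormalBasis ι ℝ E) :
    iIndepFun (fun j z => inner ℝ (b j) z) (stdGaussian E) :=
  (iIndepFun_iff_hasLaw_pi_pi (hasLaw_inner_stdGaussian b)).2
    ⟨by fun_prop, map_inner_stdGaussian b⟩

end StdGaussianCoordinates

section QuadraticForm

lemma sum_quadratic_pow_four_moment_le {ι : Type*} [Fintype ι] {a b : ι → ℝ} {C : ℝ}
    (ha : ∀ j, |a j| ≤ C) :
    ∑ j, (60 * a j ^ 4 + 240 * a j ^ 2 * b j ^ 2 + 48 * b j ^ 4) ≤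
      max 1 (C ^ 2) * (60 * ∑ j, a j ^ 2 + 240 * (∑ j, a j ^ 2) * ∑ j, b j ^ 2 +
        48 * (∑ j, b j ^ 2) ^ 2) := by
  have ha4 : ∑ j, a j ^ 4 ≤ max 1 (C ^ 2) * ∑ j, a j ^ 2 := by
    rw [Finset.mul_sum]
    refine Finset.sum_le_sum fun j _ => ?_
    have : a j ^ 2 ≤ C ^ 2 := sq_le_sq' (neg_le_of_abs_le (ha j)) (le_of_abs_le (ha j))
    rw [show a j ^ 4 = a j ^ 2 * a j ^ 2 by ring]
    gcongr
    exact this.trans (le_max_right _ _)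
  have hab : ∑ j, a j ^ 2 * b j ^ 2 ≤ (∑ j, a j ^ 2) * ∑ j, b j ^ 2 := by
    rw [Finset.sum_mul]
    gcongr with j
    exact Finset.single_le_sum (f := fun j => b j ^ 2) (fun i _ => sq_nonneg _) (Finset.mem_univ j)
  have hb4 : ∑ j, b j ^ 4 ≤ (∑ j, b j ^ 2) ^ 2 := by
    simpa only [← pow_mul] using
      Finset.sum_sq_le_sq_sum_of_nonneg (s := Finset.univ) fun j _ => sq_nonneg (b j)
  have hrest := le_mul_of_one_le_left (a := max 1 (C ^ 2))
    (b := 240 * ((∑ j, a j ^ 2) * ∑ j, b j ^ 2) + 48 * (∑ j, b j ^ 2) ^ 2)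
    (by positivity) (le_max_left _ _)
  simp only [mul_assoc, Finset.sum_add_distrib, ← Finset.mul_sum]
  linarith

variable {ι : Type*} [Fintype ι] [DecidableEq ι] {B : Matrix ι ι ℝ}

lemma trace_sq_eq_sum_eigenvalues_sq (hB : B.IsHermitian) :
    (B ^ 2).trace = ∑ j, hB.eigenvalues j ^ 2 := by
  conv_lhs => rw [hB.spectral_theorem, ← map_pow, Unitary.conjStarAlgAut_apply,
    Matrix.trace_mul_cycle, Unitary.coe_star_mul_self, one_mul, Matrix.diagonal_pow]
  simp [Matrix.trace_diagonal]

lemma inner_eigenvectorBasis_toEuclideanCLM (hB : B.IsHermitian) (z : EuclideanSpace ℝ ι) (j : ι) :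
    inner ℝ (hB.eigenvectorBasis j) (Matrix.toEuclideanCLM (𝕜 := ℝ) B z) =
      hB.eigenvalues j * inner ℝ (hB.eigenvectorBasis j) z := by
  rw [Matrix.inner_toEuclideanCLM, Matrix.dotProduct_mulVec, ← Matrix.mulVec_transpose,
    ← Matrix.conjTranspose_eq_transpose_of_trivial, hB.eq, hB.mulVec_eigenvectorBasis,
    smul_dotProduct, EuclideanSpace.inner_eq_star_dotProduct, dotProduct_comm]
  simp

lemma dotProduct_mulVec_eq_sum_eigenvalues_mul_sq (hB : B.IsHermitian)
    (z : EuclideanSpace ℝ ι) :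
    z.ofLp ⬝ᵥ (B *ᵥ z.ofLp) =
      ∑ j, hB.eigenvalues j * inner ℝ (hB.eigenvectorBasis j) z ^ 2 := by
  rw [← Matrix.inner_toEuclideanCLM, ← hB.eigenvectorBasis.sum_inner_mul_inner]
  refine Finset.sum_congr rfl fun j _ => ?_
  rw [inner_eigenvectorBasis_toEuclideanCLM, real_inner_comm]
  ring

end QuadraticForm

noncomputable section EigenTerm

variable {p : ℕ} {B : Matrix (Fin p) (Fin p) ℝ}

/-- The contribution of the `j`-th eigenvector of `B` to the numerator of `quadStat B r z`; under
the standard Gaussian law these contributions are independent. -/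
def eigenTerm (hB : B.IsHermitian) (r : EuclideanSpace ℝ (Fin p)) (j : Fin p)
    (z : EuclideanSpace ℝ (Fin p)) : ℝ :=
  hB.eigenvalues j * (inner ℝ (hB.eigenvectorBasis j) z ^ 2 - 1) +
    2 * inner ℝ (hB.eigenvectorBasis j) r * inner ℝ (hB.eigenvectorBasis j) z

lemma quadStat_eq_sum_eigenTerm (hB : B.IsHermitian) (r z : EuclideanSpace ℝ (Fin p)) :
    quadStat B r z = (∑ j, eigenTerm hB r j z) / √(quadVar B r) := by
  have hzr : z.ofLp ⬝ᵥ r.ofLp =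
      ∑ j, inner ℝ (hB.eigenvectorBasis j) r * inner ℝ (hB.eigenvectorBasis j) z := by
    rw [← star_trivial r.ofLp, ← EuclideanSpace.inner_eq_star_dotProduct,
      ← hB.eigenvectorBasis.sum_inner_mul_inner r z]
    simp only [real_inner_comm (hB.eigenvectorBasis _) r]
  rw [quadStat, dotProduct_mulVec_eq_sum_eigenvalues_mul_sq hB, hzr, hB.trace_eq_sum_eigenvalues,
    Finset.mul_sum, ← Finset.sum_add_distrib, ← Finset.sum_sub_distrib]
  congr 1
  refine Finset.sum_congr rfl fun j _ => ?_
  rw [eigenTerm, RCLike.ofReal_real_eq_id, id]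
  ring

lemma iIndepFun_eigenTerm (hB : B.IsHermitian) (r : EuclideanSpace ℝ (Fin p)) :
    iIndepFun (eigenTerm hB r) (stdGaussian (EuclideanSpace ℝ (Fin p))) :=
  (iIndepFun_inner_stdGaussian hB.eigenvectorBasis).comp
    (fun j x => hB.eigenvalues j * (x ^ 2 - 1) + 2 * inner ℝ (hB.eigenvectorBasis j) r * x)
    fun j => by fun_prop

lemma memLp_eigenTerm (hB : B.IsHermitian) (r : EuclideanSpace ℝ (Fin p)) (j : Fin p) :
    MemLp (eigenTerm hB r j) 4 (stdGaussian (EuclideanSpace ℝ (Fin p))) := by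
  have hx := hasLaw_inner_stdGaussian hB.eigenvectorBasis j
  have h := memLp_quadratic_gaussianReal 1 (hB.eigenvalues j)
    (inner ℝ (hB.eigenvectorBasis j) r) 1 (p := 4) (by simp)
  rw [← hx.map_eq] at h
  exact h.comp_of_map hx.aemeasurable

lemma integral_eigenTerm_pow (hB : B.IsHermitian) (r : EuclideanSpace ℝ (Fin p)) (j : Fin p)
    (m : ℕ) :
    ∫ z, eigenTerm hB r j z ^ m ∂(stdGaussian (EuclideanSpace ℝ (Fin p))) =
      ∫ x, (hB.eigenvalues j * (x ^ 2 - 1) + 2 * inner ℝ (hB.eigenvectorBasis j) r * x) ^ m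
        ∂(gaussianReal 0 1) :=
  (hasLaw_inner_stdGaussian hB.eigenvectorBasis j).integral_comp (f := fun x =>
    (hB.eigenvalues j * (x ^ 2 - 1) + 2 * inner ℝ (hB.eigenvectorBasis j) r * x) ^ m)
    (by fun_prop)

lemma integral_eigenTerm (hB : B.IsHermitian) (r : EuclideanSpace ℝ (Fin p)) (j : Fin p) :
    ∫ z, eigenTerm hB r j z ∂(stdGaussian (EuclideanSpace ℝ (Fin p))) = 0 := by
  simpa only [pow_one, integral_quadratic_gaussianReal] using integral_eigenTerm_pow hB r j 1

lemma sum_integral_eigenTerm_sq (hB : B.IsHermitian) (r : EuclideanSpace ℝ (Fin p)) :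
    ∑ j, ∫ z, eigenTerm hB r j z ^ 2 ∂(stdGaussian (EuclideanSpace ℝ (Fin p))) =
      quadVar B r := by
  simp only [integral_eigenTerm_pow, integral_quadratic_sq_gaussianReal, Finset.sum_add_distrib,
    ← Finset.mul_sum, ← trace_sq_eq_sum_eigenvalues_sq,
    hB.eigenvectorBasis.sum_sq_inner_right, quadVar]

lemma sum_integral_eigenTerm_pow_four_le (hB : B.IsHermitian) (r : EuclideanSpace ℝ (Fin p))
    {C : ℝ} (hC : ∀ j, |hB.eigenvalues j| ≤ C) :
    ∑ j, ∫ z, eigenTerm hB r j z ^ 4 ∂(stdGaussian (EuclideanSpace ℝ (Fin p))) ≤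
      max 1 (C ^ 2) * (60 * (B ^ 2).trace + 240 * (B ^ 2).trace * ‖r‖ ^ 2 + 48 * ‖r‖ ^ 4) := by
  rw [trace_sq_eq_sum_eigenvalues_sq hB, show ‖r‖ ^ 4 = (‖r‖ ^ 2) ^ 2 by ring,
    ← hB.eigenvectorBasis.sum_sq_inner_right r]
  simp only [integral_eigenTerm_pow, integral_quadratic_pow_four_gaussianReal]
  exact sum_quadratic_pow_four_moment_le hC

theorem LyapunovCond.tendstoInDistribution_quadStat {p : ℕ → ℕ}
    {B : (k : ℕ) → Matrix (Fin (p k)) (Fin (p k)) ℝ} {r : (k : ℕ) → EuclideanSpace ℝ (Fin (p k))}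
    (h : LyapunovCond B r) (hB : ∀ k, (B k).IsHermitian) {C : ℝ}
    (hC : ∀ᶠ k in atTop, ∀ j, |(hB k).eigenvalues j| ≤ C) :
    TendstoInDistribution (fun k => quadStat (B k) (r k)) atTop (id : ℝ → ℝ)
      (fun k => stdGaussian (EuclideanSpace ℝ (Fin (p k)))) (gaussianReal 0 1) := by
  have hlyap : Tendsto (fun k =>
      (∑ j, ∫ z, eigenTerm (hB k) (r k) j z ^ 4 ∂(stdGaussian (EuclideanSpace ℝ (Fin (p k))))) /
        quadVar (B k) (r k) ^ 2) atTop (𝓝 0) := by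
    refine squeeze_zero' (.of_forall fun k => by positivity) (hC.mono fun k hk => ?_)
      (by simpa only [mul_zero] using h.2.const_mul (max 1 (C ^ 2)))
    rw [lyapunovRatio, ← mul_div_assoc]
    grw [sum_integral_eigenTerm_pow_four_le (hB k) (r k) hk]
  have hclt := tendstoInDistribution_sum_div_sqrt_of_lyapunov
    (fun k => memLp_eigenTerm (hB k) (r k)) (fun k => integral_eigenTerm (hB k) (r k))
    (fun k => iIndepFun_eigenTerm (hB k) (r k))
  simp only [sum_integral_eigenTerm_sq] at hclt
  simpa only [← quadStat_eq_sum_eigenTerm] using hclt h.1 hlyap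

end EigenTerm

section RidgeBounds

section Loewner

variable {ι : Type*} [Fintype ι] [DecidableEq ι] {A B : Matrix ι ι ℝ}

lemma inv_one_add_le_one_of_nonneg (hA : 0 ≤ A) : (1 + A)⁻¹ ≤ 1 := by
  have hpos : (1 + A).PosDef := Matrix.PosDef.one.add_posSemidef (Matrix.nonneg_iff_posSemidef.1 hA)
  set H := (1 + A)⁻¹
  have hH : H.IsHermitian := hpos.inv.isHermitian
  have hdet : IsUnit (1 + A).det := (Matrix.isUnit_iff_isUnit_det _).1 hpos.isUnit
  have hmul : H * (1 + A) = 1 := Matrix.nonsing_inv_mul _ hdet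
  have hmul' : (1 + A) * H = 1 := Matrix.mul_nonsing_inv _ hdet
  have h : 1 - H = star H * (A + star A * A) * H := by
    rw [hH.star_eq, (IsSelfAdjoint.of_nonneg hA).star_eq]
    calc 1 - H = H * (1 + A) - H := by rw [hmul]
      _ = H * A * ((1 + A) * H) := by rw [hmul']; noncomm_ring
      _ = _ := by noncomm_ring
  rw [← sub_nonneg, h]
  exact star_left_conjugate_nonneg (add_nonneg hA (star_mul_self_nonneg A)) H

lemma abs_eigenvalues_le_of_neg_le_of_le (hB : B.IsHermitian) (h₁ : -A ≤ B) (h₂ : B ≤ A) (j : ι) :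
    |hB.eigenvalues j| ≤ ‖Matrix.toEuclideanCLM (𝕜 := ℝ) A‖ := by
  set u := hB.eigenvectorBasis j
  have hu : ‖u‖ = 1 := hB.eigenvectorBasis.orthonormal.norm_eq_one j
  have hBu : hB.eigenvalues j = u.ofLp ⬝ᵥ (B *ᵥ u.ofLp) := by simpa using hB.eigenvalues_eq j
  have hAu : u.ofLp ⬝ᵥ (A *ᵥ u.ofLp) ≤ ‖Matrix.toEuclideanCLM (𝕜 := ℝ) A‖ := by
    rw [← Matrix.inner_toEuclideanCLM]
    grw [real_inner_le_norm, ContinuousLinearMap.le_opNorm]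
    simp [hu]
  have h₁' := (Matrix.nonneg_iff_posSemidef.1 (sub_nonneg.2 h₁)).dotProduct_mulVec_nonneg u.ofLp
  have h₂' := (Matrix.nonneg_iff_posSemidef.1 (sub_nonneg.2 h₂)).dotProduct_mulVec_nonneg u.ofLp
  simp only [Matrix.sub_mulVec, Matrix.neg_mulVec, dotProduct_sub, dotProduct_neg, star_trivial,
    ← hBu] at h₁' h₂'
  exact abs_le.2 ⟨by linarith, by linarith⟩

end Loewner

variable {p m : ℕ} {γ : ℝ}

lemma sampleCov_nonneg (x : Fin m → EuclideanSpace ℝ (Fin p)) : 0 ≤ sampleCov x := by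
  rcases Nat.eq_zero_or_pos m with rfl | hm
  · simp [sampleCov]
  · have hm' : (0 : ℝ) ≤ ((m : ℝ) - 1)⁻¹ := by
      rw [inv_nonneg, sub_nonneg]
      exact_mod_cast hm
    refine smul_nonneg hm' (Finset.sum_nonneg fun l _ => Matrix.nonneg_iff_posSemidef.2 ?_)
    simpa using Matrix.posSemidef_vecMulVec_self_star (x l - sampleMean x).ofLp

lemma isHermitian_ridgeInv (γ : ℝ) (x : Fin m → EuclideanSpace ℝ (Fin p)) :
    (ridgeInv γ x).IsHermitian :=
  (Matrix.isHermitian_one.add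
    (.smul (IsSelfAdjoint.of_nonneg (sampleCov_nonneg x)) (.all γ))).inv

lemma posDef_one_add_smul_sampleCov (hγ : 0 ≤ γ) (x : Fin m → EuclideanSpace ℝ (Fin p)) :
    (1 + γ • sampleCov x).PosDef :=
  Matrix.PosDef.one.add_posSemidef
    (Matrix.nonneg_iff_posSemidef.1 (smul_nonneg hγ (sampleCov_nonneg x)))

lemma ridgeInv_nonneg (hγ : 0 ≤ γ) (x : Fin m → EuclideanSpace ℝ (Fin p)) : 0 ≤ ridgeInv γ x :=
  Matrix.nonneg_iff_posSemidef.2 (posDef_one_add_smul_sampleCov hγ x).inv.posSemidef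

lemma ridgeInv_le_one (hγ : 0 ≤ γ) (x : Fin m → EuclideanSpace ℝ (Fin p)) : ridgeInv γ x ≤ 1 :=
  inv_one_add_le_one_of_nonneg (smul_nonneg hγ (sampleCov_nonneg x))

variable {n : Fin 2 → ℕ} {S : Fin 2 → Matrix (Fin p) (Fin p) ℝ}

lemma isHermitian_qdaB (γ : ℝ) (S : Fin 2 → Matrix (Fin p) (Fin p) ℝ)
    (x : TrainingSet p n) (i : Fin 2) : (qdaB γ S x i).IsHermitian :=
  ((isHermitian_ridgeInv γ (x 1)).isSelfAdjoint.sub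
    (isHermitian_ridgeInv γ (x 0)).isSelfAdjoint).conjugate_self
    (.of_nonneg (CFC.sqrt_nonneg (S i)))

lemma qdaB_le (hγ : 0 ≤ γ) {i : Fin 2} (hS : 0 ≤ S i) (x : TrainingSet p n) :
    qdaB γ S x i ≤ S i := by
  have hdiff : ridgeInv γ (x 1) - ridgeInv γ (x 0) ≤ 1 :=
    (sub_le_self _ (ridgeInv_nonneg hγ (x 0))).trans (ridgeInv_le_one hγ (x 1))
  simpa only [qdaB, mul_one, CFC.sqrt_mul_sqrt_self _ hS] using
    conjugate_le_conjugate_of_nonneg hdiff (CFC.sqrt_nonneg (S i))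

lemma neg_le_qdaB (hγ : 0 ≤ γ) {i : Fin 2} (hS : 0 ≤ S i) (x : TrainingSet p n) :
    -S i ≤ qdaB γ S x i := by
  have hdiff : -1 ≤ ridgeInv γ (x 1) - ridgeInv γ (x 0) := by
    rw [neg_le, neg_sub]
    exact (sub_le_self _ (ridgeInv_nonneg hγ (x 1))).trans (ridgeInv_le_one hγ (x 0))
  simpa only [qdaB, mul_neg, neg_mul, mul_one, CFC.sqrt_mul_sqrt_self _ hS] using
    conjugate_le_conjugate_of_nonneg hdiff (CFC.sqrt_nonneg (S i))

lemma abs_eigenvalues_qdaB_le (hγ : 0 ≤ γ) {i : Fin 2} (hS : 0 ≤ S i) (x : TrainingSet p n)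
    (j : Fin p) : |(isHermitian_qdaB γ S x i).eigenvalues j| ≤
      ‖Matrix.toEuclideanCLM (𝕜 := ℝ) (S i)‖ :=
  abs_eigenvalues_le_of_neg_le_of_le _ (neg_le_qdaB hγ hS x) (qdaB_le hγ hS x) j

end RidgeBounds

section Measurability

variable {p m : ℕ}

lemma continuous_sampleMean :
    Continuous (sampleMean : (Fin m → EuclideanSpace ℝ (Fin p)) → EuclideanSpace ℝ (Fin p)) := by
  unfold sampleMean
  fun_prop

lemma continuous_sampleCov :
    Continuous (sampleCov : (Fin m → EuclideanSpace ℝ (Fin p)) → Matrix (Fin p) (Fin p) ℝ) := by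
  have := continuous_sampleMean (p := p) (m := m)
  unfold sampleCov
  fun_prop

variable {γ : ℝ}

lemma continuous_ridgeInv (hγ : 0 ≤ γ) :
    Continuous (ridgeInv γ : (Fin m → EuclideanSpace ℝ (Fin p)) → Matrix (Fin p) (Fin p) ℝ) := by
  have := continuous_sampleCov (p := p) (m := m)
  have hdet (x : Fin m → EuclideanSpace ℝ (Fin p)) : (1 + γ • sampleCov x).det ≠ 0 :=
    (posDef_one_add_smul_sampleCov hγ x).det_pos.ne'
  unfold ridgeInv
  simp only [Matrix.inv_def, Ring.inverse_eq_inv']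
  fun_prop (disch := exact hdet _)

variable {n : Fin 2 → ℕ}

lemma continuous_qdaB (hγ : 0 ≤ γ) (S : Fin 2 → Matrix (Fin p) (Fin p) ℝ) (i : Fin 2) :
    Continuous fun x : TrainingSet p n => qdaB γ S x i := by
  have h (j : Fin 2) := continuous_ridgeInv (p := p) (m := n j) hγ
  unfold qdaB
  fun_prop

lemma continuous_qdaR (hγ : 0 ≤ γ) (μ : Fin 2 → EuclideanSpace ℝ (Fin p))
    (S : Fin 2 → Matrix (Fin p) (Fin p) ℝ) (i : Fin 2) :
    Continuous fun x : TrainingSet p n => qdaR γ μ S x i := by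
  have h (j : Fin 2) := continuous_ridgeInv (p := p) (m := n j) hγ
  have h' (j : Fin 2) := continuous_sampleMean (p := p) (m := n j)
  unfold qdaR
  fun_prop

lemma measurable_quadStat_of_continuous {α : Type*} [TopologicalSpace α] [MeasurableSpace α]
    [OpensMeasurableSpace α] {B : α → Matrix (Fin p) (Fin p) ℝ}
    {r z : α → EuclideanSpace ℝ (Fin p)} (hB : Continuous B) (hr : Continuous r)
    (hz : Continuous z) : Measurable fun a => quadStat (B a) (r a) (z a) := by
  unfold quadStat quadVar
  exact Measurable.div (Continuous.measurable (by fun_prop)) (Continuous.measurable (by fun_prop))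

lemma measurable_quadStat_qda (hγ : 0 ≤ γ) (μ : Fin 2 → EuclideanSpace ℝ (Fin p))
    (S : Fin 2 → Matrix (Fin p) (Fin p) ℝ) (i : Fin 2) :
    Measurable fun q : TrainingSet p n × EuclideanSpace ℝ (Fin p) =>
      quadStat (qdaB γ S q.1 i) (qdaR γ μ S q.1 i) q.2 :=
  measurable_quadStat_of_continuous ((continuous_qdaB hγ S i).comp continuous_fst)
    ((continuous_qdaR hγ μ S i).comp continuous_fst) continuous_snd

end Measurability

section ConditionalLaw

variable {Ω α β E : Type*} [MeasurableSpace Ω] [MeasurableSpace α] [MeasurableSpace β]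
  [MeasurableSpace E] {P : Measure Ω} [IsProbabilityMeasure P]

lemma condDistrib_comp_prodMk_ae_eq_of_indepFun [StandardBorelSpace E] [Nonempty E]
    {X : Ω → α} {Y : Ω → β} {ν : Measure β} [IsProbabilityMeasure ν] (hX : AEMeasurable X P)
    (hY : HasLaw Y ν P) (hXY : IndepFun X Y P) {g : α × β → E} (hg : Measurable g) :
    ∀ᵐ ω ∂P, condDistrib (fun ω => g (X ω, Y ω)) X P (X ω) = ν.map fun y => g (X ω, y) := by
  let κ : Kernel α E := (Kernel.id ×ₖ Kernel.const α ν).map g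
  have hκ (x : α) : κ x = ν.map fun y => g (x, y) := by
    rw [Kernel.map_apply _ hg, Kernel.prod_apply, Kernel.id_apply, Kernel.const_apply,
      Measure.dirac_prod, Measure.map_map hg (by fun_prop), Function.comp_def]
  have : IsMarkovKernel κ := Kernel.IsMarkovKernel.map _ hg
  have := Measure.isProbabilityMeasure_map hX
  have hXYm : AEMeasurable (fun ω => (X ω, Y ω)) P := hX.prodMk hY.aemeasurable
  have hgraph : P.map (fun ω => (X ω, g (X ω, Y ω))) = P.map X ⊗ₘ κ := by
    calc P.map (fun ω => (X ω, g (X ω, Y ω)))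
        = (P.map fun ω => (X ω, Y ω)).map fun q => (q.1, g q) := by
          rw [AEMeasurable.map_map_of_aemeasurable (by fun_prop) hXYm, Function.comp_def]
      _ = ((P.map X).prod ν).map fun q => (q.1, g q) := by
          rw [(indepFun_iff_map_prod_eq_prod_map_map hX hY.aemeasurable).1 hXY, hY.map_eq]
      _ = P.map X ⊗ₘ κ := by
          ext s hs
          have hq : Measurable fun q : α × β => (q.1, g q) := by fun_prop
          rw [Measure.map_apply hq hs, Measure.prod_apply (hq hs), Measure.compProd_apply hs]
          refine lintegral_congr fun x => ?_
          rw [hκ, Measure.map_apply (by fun_prop) (measurable_prodMk_left hs)]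
          rfl
  have h := condDistrib_ae_eq_of_measure_eq_compProd X (hg.comp_aemeasurable hXYm) hgraph
  filter_upwards [ae_of_ae_map hX h] with ω hω
  exact hω.trans (hκ _)

lemma integral_integral_condDistrib [StandardBorelSpace E] [Nonempty E]
    {F : Type*} [NormedAddCommGroup F] [NormedSpace ℝ F] {X : Ω → α} {Z : Ω → E}
    (hX : AEMeasurable X P) (hZ : AEMeasurable Z P) {f : α × E → F}
    (hf : Integrable f (P.map fun ω => (X ω, Z ω))) :
    ∫ ω, ∫ y, f (X ω, y) ∂condDistrib Z X P (X ω) ∂P = ∫ ω, f (X ω, Z ω) ∂P := by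
  rw [← integral_map (hX.prodMk hZ) hf.1, ← compProd_map_condDistrib hZ,
    Measure.integral_compProd (by rwa [compProd_map_condDistrib hZ]),
    integral_map hX (hf.1.integral_condDistrib_map hZ)]

theorem tendstoInDistribution_of_ae_tendsto_condDistrib [TopologicalSpace E] [PolishSpace E]
    [BorelSpace E] [Nonempty E] {α : ℕ → Type*} [∀ k, MeasurableSpace (α k)]
    {X : (k : ℕ) → Ω → α k} {Z : ℕ → Ω → E} {ν : Measure E} [IsProbabilityMeasure ν]
    (hX : ∀ k, AEMeasurable (X k) P) (hZ : ∀ k, AEMeasurable (Z k) P)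
    (h : ∀ᵐ ω ∂P, Tendsto (β := ProbabilityMeasure E)
      (fun k => ⟨condDistrib (Z k) (X k) P (X k ω), inferInstance⟩) atTop
      (𝓝 ⟨ν, inferInstance⟩)) :
    TendstoInDistribution Z atTop (id : E → E) (fun _ => P) ν := by
  refine ⟨hZ, aemeasurable_id, ?_⟩
  simp only [Measure.map_id]
  refine ProbabilityMeasure.tendsto_iff_forall_integral_tendsto.2 fun f => ?_
  have hmean (k : ℕ) : ∫ y, f y ∂P.map (Z k) =
      ∫ ω, ∫ y, f y ∂condDistrib (Z k) (X k) P (X k ω) ∂P := by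
    have := Measure.isProbabilityMeasure_map ((hX k).prodMk (hZ k))
    rw [integral_map (hZ k) (by fun_prop)]
    exact (integral_integral_condDistrib (hX k) (hZ k) (f := fun q => f q.2)
      (.of_bound (by fun_prop) ‖f‖ (ae_of_all _ fun q => f.norm_coe_le_norm q.2))).symm
  have hlim : ∀ᵐ ω ∂P, Tendsto (fun k => ∫ y, f y ∂condDistrib (Z k) (X k) P (X k ω)) atTop
      (𝓝 (∫ y, f y ∂ν)) := by
    filter_upwards [h] with ω hω
    exact ProbabilityMeasure.tendsto_iff_forall_integral_tendsto.1 hω f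
  simp only [ProbabilityMeasure.coe_mk, hmean]
  rw [show ∫ y, f y ∂ν = ∫ _, ∫ y, f y ∂ν ∂P by simp]
  refine tendsto_integral_of_dominated_convergence (fun _ => ‖f‖) (fun k => ?_)
    (integrable_const _) (fun k => ae_of_all _ fun ω => f.norm_integral_le_norm _) hlim
  exact (f.continuous.measurable.comp measurable_snd).aestronglyMeasurable.integral_condDistrib
    (hX k) (hZ k)

end ConditionalLaw

theorem proposition1_general
    (p : ℕ → ℕ) (n : Fin 2 → ℕ → ℕ) (γ : ℝ) (hγ : 0 ≤ γ)
    (μ : Fin 2 → (k : ℕ) → EuclideanSpace ℝ (Fin (p k)))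
    (S : Fin 2 → (k : ℕ) → Matrix (Fin (p k)) (Fin (p k)) ℝ)
    (i : Fin 2) (hS : ∀ k, (S i k).PosSemidef)
    (hSbdd : (fun k => ‖Matrix.toEuclideanCLM (𝕜 := ℝ) (S i k)‖) =O[atTop] (fun _ => (1 : ℝ)))
    {Ω : Type*} [MeasurableSpace Ω] (P : Measure Ω) [IsProbabilityMeasure P]
    (X : (k : ℕ) → Ω → TrainingSet (p k) (fun j => n j k))
    (z : (k : ℕ) → Ω → EuclideanSpace ℝ (Fin (p k)))
    (hX : ∀ k, AEMeasurable (X k) P)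
    (hz : ∀ k, HasLaw (z k) (stdGaussian (EuclideanSpace ℝ (Fin (p k)))) P)
    (hXz : ∀ k, IndepFun (X k) (z k) P) :
    let B : (k : ℕ) → Ω → Matrix (Fin (p k)) (Fin (p k)) ℝ :=
      fun k ω => qdaB γ (fun j => S j k) (X k ω) i
    let r : (k : ℕ) → Ω → EuclideanSpace ℝ (Fin (p k)) :=
      fun k ω => qdaR γ (fun j => μ j k) (fun j => S j k) (X k ω) i
    let Z : (k : ℕ) → Ω → ℝ := fun k ω => quadStat (B k ω) (r k ω) (z k ω)
    (∀ᵐ ω ∂P, LyapunovCond (fun k => B k ω) (fun k => r k ω) →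
      Tendsto (β := ProbabilityMeasure ℝ)
        (fun k => ⟨condDistrib (Z k) (X k) P (X k ω), inferInstance⟩) atTop
        (𝓝 ⟨gaussianReal 0 1, inferInstance⟩)) ∧
    ((∀ᵐ ω ∂P, LyapunovCond (fun k => B k ω) (fun k => r k ω)) →
      TendstoInDistribution Z atTop (id : ℝ → ℝ) (fun _ => P) (gaussianReal 0 1)) := by
  intro B r Z
  obtain ⟨C, hC⟩ := hSbdd.bound
  have hBbdd (ω : Ω) : ∀ᶠ k in atTop,
      ∀ j, |(isHermitian_qdaB γ (fun j => S j k) (X k ω) i).eigenvalues j| ≤ C := by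
    filter_upwards [hC] with k hk j
    exact (abs_eigenvalues_qdaB_le hγ (hS k).nonneg (X k ω) j).trans (by simpa using hk)
  have hg (k : ℕ) := measurable_quadStat_qda (n := fun j => n j k) hγ (fun j => μ j k)
    (fun j => S j k) i
  have hZ (k : ℕ) : AEMeasurable (Z k) P := by
    simpa only [Function.comp_def] using
      (hg k).comp_aemeasurable ((hX k).prodMk (hz k).aemeasurable)
  have hlaw (k : ℕ) : ∀ᵐ ω ∂P, condDistrib (Z k) (X k) P (X k ω) =
      (stdGaussian (EuclideanSpace ℝ (Fin (p k)))).map fun y => quadStat (B k ω) (r k ω) y :=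
    condDistrib_comp_prodMk_ae_eq_of_indepFun (hX k) (hz k) (hXz k) (hg k)
  have hcond : ∀ᵐ ω ∂P, LyapunovCond (fun k => B k ω) (fun k => r k ω) →
      Tendsto (β := ProbabilityMeasure ℝ)
        (fun k => ⟨condDistrib (Z k) (X k) P (X k ω), inferInstance⟩) atTop
        (𝓝 ⟨gaussianReal 0 1, inferInstance⟩) := by
    filter_upwards [ae_all_iff.2 hlaw] with ω hω hlyap
    have hlim := (hlyap.tendstoInDistribution_quadStat
      (fun k => isHermitian_qdaB γ _ (X k ω) i) (hBbdd ω)).tendsto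
    simpa only [Measure.map_id, ← hω] using hlim
  refine ⟨hcond, fun hlyap => tendstoInDistribution_of_ae_tendsto_condDistrib hX hZ ?_⟩
  filter_upwards [hcond, hlyap] with ω hω hω'
  exact hω hω'

theorem proposition1
    -- dimensions, sample sizes, regularization parameter, class means and covariance matrices
    (p : ℕ → ℕ) (n : Fin 2 → ℕ → ℕ) (γ c : ℝ) (hγ : 0 < γ) (hc : 0 < c)
    (μ : Fin 2 → (k : ℕ) → EuclideanSpace ℝ (Fin (p k)))
    (S : Fin 2 → (k : ℕ) → Matrix (Fin (p k)) (Fin (p k)) ℝ)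
    (hS : ∀ i k, (S i k).PosSemidef)
    -- double asymptotic regime
    (hp : Tendsto p atTop atTop) (hn : ∀ i, Tendsto (n i) atTop atTop)
    (hn01 : Tendsto (fun k => (n 0 k : ℝ) - (n 1 k : ℝ)) atTop (𝓝 0))
    (hpn : Tendsto (fun k => (p k : ℝ) / ((n 0 k : ℝ) + (n 1 k : ℝ))) atTop (𝓝 c))
    -- mean scaling
    (hμ : (fun k => ‖μ 0 k - μ 1 k‖ ^ 2) =O[atTop] (fun k => √(p k)))
    -- covariance scaling, in spectral norm
    (hSbdd : ∀ i, (fun k => ‖Matrix.toEuclideanCLM (𝕜 := ℝ) (S i k)‖) =O[atTop]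
      (fun _ => (1 : ℝ)))
    (hSdiff : FewLargeEigenvalues
      (fun k => (hS 0 k).isHermitian.sub (hS 1 k).isHermitian))
    -- independent Gaussian training samples and the independent vector `z`
    {Ω : Type*} [MeasurableSpace Ω] (P : Measure Ω) [IsProbabilityMeasure P]
    (X : (k : ℕ) → Ω → TrainingSet (p k) (fun i => n i k))
    (z : (k : ℕ) → Ω → EuclideanSpace ℝ (Fin (p k)))
    (hX : ∀ k i l, HasLaw (fun ω => X k ω i l) (multivariateGaussian (μ i k) (S i k)) P)
    (hXindep : ∀ k, iIndepFun
      (fun (a : (i : Fin 2) × Fin (n i k)) ω => X k ω a.1 a.2) P)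
    (hz : ∀ k, HasLaw (z k) (stdGaussian (EuclideanSpace ℝ (Fin (p k)))) P)
    (hXz : ∀ k, IndepFun (X k) (z k) P)
    (i : Fin 2) :
    let B : (k : ℕ) → Ω → Matrix (Fin (p k)) (Fin (p k)) ℝ :=
      fun k ω => qdaB γ (fun j => S j k) (X k ω) i
    let r : (k : ℕ) → Ω → EuclideanSpace ℝ (Fin (p k)) :=
      fun k ω => qdaR γ (fun j => μ j k) (fun j => S j k) (X k ω) i
    let Z : (k : ℕ) → Ω → ℝ := fun k ω => quadStat (B k ω) (r k ω) (z k ω)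
    -- conditionally on the training samples, almost surely where the condition holds
    (∀ᵐ ω ∂P, LyapunovCond (fun k => B k ω) (fun k => r k ω) →
      Tendsto (β := ProbabilityMeasure ℝ)
        (fun k => ⟨condDistrib (Z k) (X k) P (X k ω), inferInstance⟩) atTop
        (𝓝 ⟨gaussianReal 0 1, inferInstance⟩)) ∧
    -- unconditionally, if the condition holds almost surely
    ((∀ᵐ ω ∂P, LyapunovCond (fun k => B k ω) (fun k => r k ω)) →
      TendstoInDistribution Z atTop (id : ℝ → ℝ) (fun _ => P) (gaussianReal 0 1)) :=
  proposition1_general p n γ hγ.le μ S i (hS i) (hSbdd i) P X z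
    (fun k => aemeasurable_pi_lambda _ fun j => aemeasurable_pi_lambda _ fun l =>
      (hX k j l).aemeasurable) hz hXz
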